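/- Let $(R,\mathfrak m,k)$ be a Noetherian local ring, let $e=\dim_k(\mathfrak m/\mathfrak m^2)$ be its embedding dimension and $c=e-\operatorname{depth}R$ its codepth. Let $\underline x=x_1,\dots,x_e$ be a minimal system of generators of $\mathfrak m$. For a finitely generated $R$-module $M$ put $h_i(M)=\dim_k H_i(\underline x;M)$, the $k$-dimension of the $i$-th Koszul homology of $M$ with respect to $\underline x$, and put $\tilde h_0(R)=0$ and $\tilde h_i(R)=h_i(R)$ for $i>0$. Let $\Omega_n k$ denote the $n$-th syzygy of $k$ in a minimal free resolution of $k$ over $R$ (so $\Omega_0k=k$), and $\beta_n(k)$ the $n$-th Betti number of $k$, that is, the rank of the $n$-th free module of this resolution, with $\beta_{-1}(k)=0$. Then for all integers $n\ge 0$ and $m\ge c$, $$h_m(\Omega_n k)=\beta_{n-1}(k)\,\tilde h_m(R)+\binom{e}{n+m},$$ where $\binom{e}{j}=0$ for $j>e$. -/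

import Mathlib

open IsLocalRing
open scoped TensorProduct

namespace KoszulSyzygy

universe u v

section Koszul

variable {R : Type u} [CommRing R] {ι : Type} [LinearOrder ι]

theorem koszulSign (t : Finset ι) {j l : ι} (hj : j ∉ t) (hl : l ∉ t) (hjl : j ≠ l) :
    (-1 : R) ^ ((insert j t).filter (· < l)).card * (-1) ^ (t.filter (· < j)).card =
      -((-1) ^ ((insert l t).filter (· < j)).card * (-1) ^ (t.filter (· < l)).card) := by
  have hj' : j ∉ t.filter (· < l) := fun h => hj (Finset.mem_filter.1 h).1
  have hl' : l ∉ t.filter (· < j) := fun h => hl (Finset.mem_filter.1 h).1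
  rcases lt_or_gt_of_ne hjl with h | h
  · rw [Finset.filter_insert, Finset.filter_insert, if_pos h, if_neg (not_lt.2 h.le),
      Finset.card_insert_of_notMem hj']
    ring
  · rw [Finset.filter_insert, Finset.filter_insert, if_neg (not_lt.2 h.le), if_pos h,
      Finset.card_insert_of_notMem hl']
    ring

variable [Fintype ι]

/-- The total Koszul differential on `K(x) ⊗ M`. A chain `∑ e_s ⊗ f s`, where for a finite set
`s = {s₁ < ⋯ < sₚ}` of indices `e_s = e_{s₁} ∧ ⋯ ∧ e_{sₚ}`, is recorded by the function `f`, and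
`∂ (e_s ⊗ a) = ∑_{j ∈ s} (-1) ^ #{l ∈ s | l < j} x_j e_{s \ {j}} ⊗ a`. -/
def koszulD (x : ι → R) (M : Type v) [AddCommGroup M] [Module R M] :
    (Finset ι → M) →ₗ[R] (Finset ι → M) where
  toFun f t := ∑ j ∈ tᶜ, ((-1) ^ (t.filter (· < j)).card * x j) • f (insert j t)
  map_add' f g := by
    ext t
    simp [Finset.sum_add_distrib]
  map_smul' a f := by
    ext t
    simp only [Pi.smul_apply, RingHom.id_apply, Finset.smul_sum]
    exact Finset.sum_congr rfl fun j _ => smul_comm _ _ _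

/-- The chains of degree `i`: those supported on index sets with `i` elements. -/
def koszulChains (R : Type u) [CommRing R] (ι : Type) (M : Type v) [AddCommGroup M] [Module R M]
    (i : ℕ) : Submodule R (Finset ι → M) where
  carrier := {f | ∀ s, s.card ≠ i → f s = 0}
  add_mem' hf hg s hs := by simp [hf s hs, hg s hs]
  zero_mem' _ _ := rfl
  smul_mem' a f hf s hs := by simp [hf s hs]

/-- The Koszul cycles `Z_i(x; M)`. -/
def koszulCycles (x : ι → R) (M : Type v) [AddCommGroup M] [Module R M] (i : ℕ) :
    Submodule R (Finset ι → M) :=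
  koszulChains R ι M i ⊓ LinearMap.ker (koszulD x M)

/-- The Koszul boundaries `B_i(x; M)`. -/
def koszulBoundaries (x : ι → R) (M : Type v) [AddCommGroup M] [Module R M] (i : ℕ) :
    Submodule R (Finset ι → M) :=
  (koszulChains R ι M (i + 1)).map (koszulD x M)

/-- The Koszul homology `H_i(x; M) = Z_i(x; M) / B_i(x; M)`. -/
abbrev KoszulHomology (x : ι → R) (M : Type v) [AddCommGroup M] [Module R M] (i : ℕ) : Type v :=
  koszulCycles x M i ⧸ (koszulBoundaries x M i).submoduleOf (koszulCycles x M i)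

theorem koszulD_koszulD (x : ι → R) (M : Type v) [AddCommGroup M] [Module R M]
    (f : Finset ι → M) : koszulD x M (koszulD x M f) = 0 := by
  ext t
  simp only [koszulD, LinearMap.coe_mk, AddHom.coe_mk, Pi.zero_apply, Finset.smul_sum, smul_smul]
  rw [Finset.sum_sigma']
  refine Finset.sum_involution (fun p _ => ⟨p.2, p.1⟩) ?_ ?_ ?_ ?_
  · rintro ⟨j, l⟩ h
    simp only [Finset.mem_sigma, Finset.mem_compl, Finset.mem_insert, not_or] at h
    have := koszulSign (R := R) t h.1 h.2.2 (Ne.symm h.2.1)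
    simp only
    rw [Finset.insert_comm j l, ← add_smul]
    convert zero_smul R _
    linear_combination (x j * x l) * this
  · rintro ⟨j, l⟩ h _ h'
    simp only [Finset.mem_sigma, Finset.mem_compl, Finset.mem_insert, not_or] at h
    simp only [Sigma.mk.injEq, heq_eq_eq] at h'
    exact h.2.1 h'.1
  · rintro ⟨j, l⟩ h
    simp only [Finset.mem_sigma, Finset.mem_compl, Finset.mem_insert, not_or] at h ⊢
    exact ⟨h.2.2, fun h' => h.2.1 h'.symm, h.1⟩
  · rintro ⟨j, l⟩ h
    rfl

/-- Boundaries are cycles. -/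
theorem koszulBoundaries_le_koszulCycles (x : ι → R) (M : Type v) [AddCommGroup M] [Module R M]
    (i : ℕ) : koszulBoundaries x M i ≤ koszulCycles x M i := by
  rintro _ ⟨f, hf, rfl⟩
  refine ⟨fun t ht => ?_, koszulD_koszulD x M f⟩
  refine Finset.sum_eq_zero fun j hj => ?_
  rw [hf, smul_zero]
  rw [Finset.card_insert_of_notMem (Finset.mem_compl.1 hj)]
  omega

theorem smul_mem_koszulBoundaries (x : ι → R) (M : Type v) [AddCommGroup M] [Module R M] (i : ℕ)
    (j : ι) {z : Finset ι → M} (hz : z ∈ koszulCycles x M i) :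
    x j • z ∈ koszulBoundaries x M i := by
  refine ⟨fun s => if j ∈ s then (-1 : R) ^ ((s.erase j).filter (· < j)).card • z (s.erase j)
    else 0, fun s hs => ?_, ?_⟩
  · simp only
    split_ifs with h
    · rw [hz.1, smul_zero]
      rw [Finset.card_erase_of_mem h]
      have := Finset.card_pos.2 ⟨j, h⟩
      omega
    · rfl
  · ext t
    simp only [koszulD, LinearMap.coe_mk, AddHom.coe_mk, Pi.smul_apply]
    by_cases hj : j ∈ t
    · obtain ⟨t', ht', rfl⟩ : ∃ t', j ∉ t' ∧ insert j t' = t :=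
        ⟨t.erase j, Finset.notMem_erase j t, Finset.insert_erase hj⟩
      have h0 : koszulD x M z t' = 0 := by
        rw [LinearMap.mem_ker.1 hz.2]
        rfl
      simp only [koszulD, LinearMap.coe_mk, AddHom.coe_mk] at h0
      rw [← Finset.insert_erase (Finset.mem_compl.2 ht'),
        Finset.sum_insert (Finset.notMem_erase _ _), ← Finset.compl_insert] at h0
      have h1 := congrArg (fun m => (-1 : R) ^ (t'.filter (· < j)).card • m) h0
      simp only [smul_add, smul_zero, smul_smul, ← mul_assoc, ← pow_add,
        Even.neg_one_pow ⟨_, rfl⟩, one_mul, Finset.smul_sum] at h1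
      rw [eq_comm, ← sub_eq_zero, ← h1, sub_eq_add_neg, ← Finset.sum_neg_distrib]
      congr 1
      refine Finset.sum_congr rfl fun l hl => ?_
      simp only [Finset.mem_compl, Finset.mem_insert, not_or] at hl
      have hs := koszulSign (R := R) t' ht' hl.2 (Ne.symm hl.1)
      have he : (insert l (insert j t')).erase j = insert l t' := by
        rw [Finset.insert_comm, Finset.erase_insert]
        simp [ht', Ne.symm hl.1]
      rw [if_pos (by simp), he, smul_smul, ← neg_smul]
      congr 1
      have hsq : (-1 : R) ^ (t'.filter (· < j)).card * (-1) ^ (t'.filter (· < j)).card = 1 := by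
        rw [← pow_add, Even.neg_one_pow ⟨_, rfl⟩]
      have hsq' : (-1 : R) ^ ((insert l t').filter (· < j)).card *
          (-1) ^ ((insert l t').filter (· < j)).card = 1 := by
        rw [← pow_add, Even.neg_one_pow ⟨_, rfl⟩]
      rw [pow_add]
      linear_combination (-x l * (-1 : R) ^ ((insert l t').filter (· < j)).card *
        (-1) ^ (t'.filter (· < j)).card) * hs +
        (x l * (-1 : R) ^ ((insert j t').filter (· < l)).card *
          (-1) ^ ((insert l t').filter (· < j)).card) * hsq +
        (x l * (-1 : R) ^ (t'.filter (· < j)).card * (-1) ^ (t'.filter (· < l)).card) * hsq'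
    · rw [Finset.sum_eq_single j]
      · rw [if_pos (Finset.mem_insert_self _ _), Finset.erase_insert hj, smul_smul,
          mul_right_comm, ← pow_add, Even.neg_one_pow ⟨_, rfl⟩, one_mul]
      · intro l hl hlj
        rw [if_neg, smul_zero]
        simp [hj, Ne.symm hlj]
      · intro h
        exact absurd (Finset.mem_compl.2 hj) h

end Koszul

section Local

variable (R : Type u) [CommRing R] [IsLocalRing R]

/-- The embedding dimension `dim_k (𝔪 / 𝔪²)`. -/
noncomputable def embDim : ℕ := Module.finrank (ResidueField R) (CotangentSpace R)

/-- The depth: the supremum of the lengths of the regular sequences in the maximal ideal. -/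
noncomputable def depth : ℕ∞ :=
  ⨆ (rs : List R) (_ : (∀ r ∈ rs, r ∈ maximalIdeal R) ∧ RingTheory.Sequence.IsRegular R rs),
    (rs.length : ℕ∞)

/-- The codepth `e - depth R`. -/
noncomputable def codepth : ℕ∞ := (embDim R : ℕ∞) - depth R

variable {R}

/-- The Koszul homology on generators of the maximal ideal is killed by the maximal ideal. -/
theorem isTorsionBySet_koszulHomology {ι : Type} [Fintype ι] [LinearOrder ι] (x : ι → R)
    (hx : Ideal.span (Set.range x) = maximalIdeal R)
    (M : Type v) [AddCommGroup M] [Module R M] (i : ℕ) :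
    Module.IsTorsionBySet R (KoszulHomology x M i) (maximalIdeal R : Set R) := by
  have key : maximalIdeal R ≤ Module.annihilator R (KoszulHomology x M i) := by
    rw [← hx, Ideal.span_le]
    rintro _ ⟨j, rfl⟩
    refine Module.mem_annihilator.2 fun m => ?_
    obtain ⟨z, rfl⟩ := Submodule.Quotient.mk_surjective _ m
    rw [← Submodule.Quotient.mk_smul, Submodule.Quotient.mk_eq_zero]
    exact smul_mem_koszulBoundaries x M i j z.2
  intro m a
  exact Module.mem_annihilator.1 (key a.2) m

/-- `h_i(M) = dim_k H_i(x; M)`, for a generating family `x` of the maximal ideal, where the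
structure of `k`-vector space on `H_i(x; M)` is the one induced by its `R`-module structure. -/
noncomputable def koszulH {ι : Type} [Fintype ι] [LinearOrder ι] (x : ι → R)
    (hx : Ideal.span (Set.range x) = maximalIdeal R)
    (M : Type v) [AddCommGroup M] [Module R M] (i : ℕ) : ℕ :=
  letI : Module (ResidueField R) (KoszulHomology x M i) :=
    (isTorsionBySet_koszulHomology x hx M i).module
  Module.finrank (ResidueField R) (KoszulHomology x M i)

/-- `h̃_0(R) = 0` and `h̃_i(R) = h_i(R)` for `i > 0`. -/
noncomputable def koszulHTilde {ι : Type} [Fintype ι] [LinearOrder ι] (x : ι → R)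
    (hx : Ideal.span (Set.range x) = maximalIdeal R) (i : ℕ) : ℕ :=
  if i = 0 then 0 else koszulH x hx R i

/-- A minimal free resolution `⋯ → R^{β₂} → R^{β₁} → R^{β₀} → M → 0`; here `d n` is the
differential from homological degree `n + 1` to homological degree `n`. -/
structure MinimalFreeResolution (R : Type u) [CommRing R] [IsLocalRing R]
    (M : Type v) [AddCommGroup M] [Module R M] where
  /-- The ranks of the free modules. -/
  rank : ℕ → ℕ
  /-- The augmentation. -/
  aug : (Fin (rank 0) → R) →ₗ[R] M
  /-- The differentials. -/
  d : ∀ n, (Fin (rank (n + 1)) → R) →ₗ[R] (Fin (rank n) → R)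
  aug_surjective : Function.Surjective aug
  exact_zero : Function.Exact (d 0) aug
  exact_succ : ∀ n, Function.Exact (d (n + 1)) (d n)
  minimal : ∀ n, LinearMap.range (d n) ≤
    maximalIdeal R • (⊤ : Submodule R (Fin (rank n) → R))

namespace MinimalFreeResolution

variable {M : Type v} [AddCommGroup M] [Module R M]

/-- The Betti number `β_i(M)`, which is `0` for `i < 0`. -/
def betti (F : MinimalFreeResolution R M) : ℤ → ℕ
  | Int.ofNat n => F.rank n
  | Int.negSucc _ => 0

/-- The `n`-th syzygy of `M`, as the cokernel of `R^{β_{n+1}} → R^{β_n}`. It is `M` itself for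
`n = 0`, and for `n ≥ 1` it is the image of `R^{β_n} → R^{β_{n-1}}`, see `syzygyZeroEquiv` and
`syzygySuccEquiv`. -/
abbrev Syzygy (F : MinimalFreeResolution R M) (n : ℕ) : Type u :=
  (Fin (F.rank n) → R) ⧸ LinearMap.range (F.d n)

/-- The zeroth syzygy of `M` is `M`. -/
noncomputable def syzygyZeroEquiv (F : MinimalFreeResolution R M) : F.Syzygy 0 ≃ₗ[R] M :=
  (Submodule.quotEquivOfEq _ _ F.exact_zero.linearMap_ker_eq.symm).trans
    (F.aug.quotKerEquivOfSurjective F.aug_surjective)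

/-- The `(n + 1)`-st syzygy of `M` is the image of `R^{β_{n+1}} → R^{β_n}`. -/
noncomputable def syzygySuccEquiv (F : MinimalFreeResolution R M) (n : ℕ) :
    F.Syzygy (n + 1) ≃ₗ[R] LinearMap.range (F.d n) :=
  (Submodule.quotEquivOfEq _ _ (F.exact_succ n).linearMap_ker_eq.symm).trans
    (F.d n).quotKerEquivRange

/-- A finitely generated module over a local ring has a minimal free cover. -/
theorem exists_minimal_cover (N : Type v) [AddCommGroup N] [Module R N] [Module.Finite R N] :
    ∃ (b : ℕ) (g : (Fin b → R) →ₗ[R] N), Function.Surjective g ∧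
      LinearMap.ker g ≤ maximalIdeal R • (⊤ : Submodule R (Fin b → R)) := by
  classical
  let B := Module.finBasis (ResidueField R) (TensorProduct R (ResidueField R) N)
  have hv : ∀ i, ∃ w : N, (1 : ResidueField R) ⊗ₜ[R] w = B i := by
    intro i
    exact TensorProduct.mk_surjective R N (ResidueField R) residue_surjective (B i)
  choose w hw using hv
  refine ⟨_, Fintype.linearCombination R w, ?_, ?_⟩
  · rw [← LinearMap.range_eq_top, Fintype.range_linearCombination]
    exact span_eq_top_of_tmul_eq_basis w B hw
  · intro a ha
    have h0 : ∑ i, residue R (a i) • B i = 0 := by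
      have := congrArg (fun y => (1 : ResidueField R) ⊗ₜ[R] y) (LinearMap.mem_ker.1 ha)
      simp only [Fintype.linearCombination_apply, TensorProduct.tmul_sum,
        TensorProduct.tmul_zero, TensorProduct.tmul_smul, hw] at this
      rw [← this]
      exact Finset.sum_congr rfl fun i _ => algebraMap_smul (ResidueField R) (a i) (B i)
    have h1 := Fintype.linearIndependent_iff.1 B.linearIndependent _ h0
    rw [pi_eq_sum_univ' a]
    refine Submodule.sum_mem _ fun i _ => Submodule.smul_mem_smul ?_ trivial
    exact (residue_eq_zero_iff _).1 (h1 i)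

/-- Finitely generated modules over Noetherian local rings have minimal free resolutions. -/
theorem nonempty [IsNoetherianRing R] [Module.Finite R M] :
    Nonempty (MinimalFreeResolution R M) := by
  obtain ⟨b, g, hg, hk⟩ := exists_minimal_cover (R := R) M
  have step : ∀ s : (Σ b : ℕ, Submodule R (Fin b → R)), ∃ (b' : ℕ)
      (f : (Fin b' → R) →ₗ[R] (Fin s.1 → R)), LinearMap.range f = s.2 ∧
        LinearMap.ker f ≤ maximalIdeal R • (⊤ : Submodule R (Fin b' → R)) := by
    rintro ⟨c, N⟩
    obtain ⟨b', f, hf, hk⟩ := exists_minimal_cover (R := R) N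
    refine ⟨b', N.subtype ∘ₗ f, ?_, ?_⟩
    · rw [LinearMap.range_comp, LinearMap.range_eq_top.2 hf, Submodule.map_top,
        Submodule.range_subtype]
    · rwa [LinearMap.ker_comp_of_ker_eq_bot _ N.ker_subtype]
  choose b' f hf hk' using step
  let s : ℕ → (Σ b : ℕ, Submodule R (Fin b → R)) := fun n =>
    Nat.rec ⟨b, LinearMap.ker g⟩ (fun _ t => ⟨b' t, LinearMap.ker (f t)⟩) n
  have hs : ∀ n, (s n).2 ≤ maximalIdeal R • (⊤ : Submodule R (Fin (s n).1 → R)) := by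
    intro n
    cases n with
    | zero => exact hk
    | succ n => exact hk' (s n)
  exact ⟨{
    rank := fun n => (s n).1
    aug := g
    d := fun n => f (s n)
    aug_surjective := hg
    exact_zero := LinearMap.exact_iff.2 (hf (s 0)).symm
    exact_succ := fun n => LinearMap.exact_iff.2 (hf (s (n + 1))).symm
    minimal := fun n => (hf (s n)).le.trans (hs n) }⟩

end MinimalFreeResolution

end Local

end KoszulSyzygy

/-! Write `Ω_n` for the syzygies of `k`, `F_n` for the free modules. For `m ≥ c`, depth sensitivity
gives `H_i(x; R) = 0` for all `i > m`, so the Koszul homology sequence of `0 → Ω_{n+1} → F_n → Ω_n →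
0` begins `0 → H_{m+1}(Ω_n) → H_m(Ω_{n+1}) → H_m(F_n)`. If the last map is zero for `m = 0` and onto
for `m > 0`, then `h_m(Ω_{n+1}) = β_n h̃_m(R) + h_{m+1}(Ω_n)`. Induction on `n` ends at `Ω_0 = k`,
where the Koszul differential vanishes and the binomial coefficient appears; along the way
`h̃_{m+1}(R) = 0` removes every other Betti term.

The core is surjectivity for `m > 0`, that is, vanishing of `H_m(F_n) → H_m(Ω_n)`. Minimality of `x`
puts cycles of positive degree in `𝔪K`, so it suffices that suitable chains `u` in `𝔪K ⊗ F_n` become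
boundaries over `Ω_n` (`toSyzygy_compLeft_mem_koszulBoundaries`). For `n = 0` they map to zero.
Otherwise the resolution differential sends `u` to a boundary `∂v` lying in `𝔪²K`. Minimality of `x`
puts `v` in `𝔪K`, one Koszul degree higher and one syzygy lower, so induction applies to `v`, and a
diagram chase returns to `u`. -/

namespace KoszulSyzygy

universe u v

/-! ### Lifting Koszul chains along linear maps -/

section Chains

variable {R : Type u} [CommRing R] {ι : Type}
  {M N P : Type*} [AddCommGroup M] [Module R M] [AddCommGroup N] [Module R N]
  [AddCommGroup P] [Module R P]

theorem compLeft_mem_koszulChains (φ : M →ₗ[R] N) {i : ℕ} {f : Finset ι → M}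
    (hf : f ∈ koszulChains R ι M i) : φ.compLeft (Finset ι) f ∈ koszulChains R ι N i :=
  fun s hs => by simp [hf s hs]

/-- A chain all of whose coefficients lie in the image of `φ` lifts along `φ`. -/
theorem exists_koszulChains_lift (φ : M →ₗ[R] N) {i : ℕ} {f : Finset ι → N}
    (hf : f ∈ koszulChains R ι N i) (h : ∀ s, f s ∈ LinearMap.range φ) :
    ∃ g ∈ koszulChains R ι M i, φ.compLeft (Finset ι) g = f := by
  choose g hg using h
  -- The chosen preimage of `0` need not be `0`, so the lift is truncated to degree `i`.
  refine ⟨fun s => if s.card = i then g s else 0, fun s hs => by simp [hs], ?_⟩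
  ext s
  by_cases hs : s.card = i
  · simp [hs, hg]
  · simp [hs, hf s hs]

theorem exists_koszulChains_lift_of_surjective {φ : M →ₗ[R] N} (hφ : Function.Surjective φ) {i : ℕ}
    {f : Finset ι → N} (hf : f ∈ koszulChains R ι N i) :
    ∃ g ∈ koszulChains R ι M i, φ.compLeft (Finset ι) g = f :=
  exists_koszulChains_lift φ hf fun s => hφ (f s)

theorem exists_koszulChains_lift_of_exact {φ : M →ₗ[R] N} {ψ : N →ₗ[R] P}
    (h : Function.Exact φ ψ) {i : ℕ} {f : Finset ι → N} (hf : f ∈ koszulChains R ι N i)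
    (hψ : ψ.compLeft (Finset ι) f = 0) :
    ∃ g ∈ koszulChains R ι M i, φ.compLeft (Finset ι) g = f :=
  exists_koszulChains_lift φ hf fun s => (h _).1 (congrFun hψ s)

theorem compLeft_injective {φ : M →ₗ[R] N} (hφ : Function.Injective φ) :
    Function.Injective (φ.compLeft (Finset ι)) :=
  hφ.comp_left

theorem compLeft_compLeft_of_exact {φ : M →ₗ[R] N} {ψ : N →ₗ[R] P}
    (h : Function.Exact φ ψ) (f : Finset ι → M) :
    ψ.compLeft (Finset ι) (φ.compLeft (Finset ι) f) = 0 := by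
  ext s
  exact h.apply_apply_eq_zero (f s)

end Chains

/-! ### Functoriality of Koszul homology and the connecting homomorphism -/

section Functoriality

variable {R : Type u} [CommRing R] {ι : Type} [LinearOrder ι] [Fintype ι]
  {M N P : Type*} [AddCommGroup M] [Module R M] [AddCommGroup N] [Module R N]
  [AddCommGroup P] [Module R P]

theorem koszulD_apply (x : ι → R) (f : Finset ι → M) (t : Finset ι) :
    koszulD x M f t = ∑ j ∈ tᶜ, ((-1) ^ (t.filter (· < j)).card * x j) • f (insert j t) :=
  rfl

theorem koszulD_compLeft (x : ι → R) (φ : M →ₗ[R] N) (f : Finset ι → M) :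
    koszulD x N (φ.compLeft (Finset ι) f) = φ.compLeft (Finset ι) (koszulD x M f) := by
  ext t
  simp [koszulD_apply]

theorem mem_koszulCycles_iff {x : ι → R} {i : ℕ} {f : Finset ι → M} :
    f ∈ koszulCycles x M i ↔ f ∈ koszulChains R ι M i ∧ koszulD x M f = 0 :=
  Iff.rfl

theorem koszulD_mem_koszulChains (x : ι → R) {i : ℕ} {f : Finset ι → M}
    (hf : f ∈ koszulChains R ι M (i + 1)) : koszulD x M f ∈ koszulChains R ι M i :=
  (koszulBoundaries_le_koszulCycles x M i ⟨f, hf, rfl⟩).1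

theorem koszulD_eq_zero_of_mem_koszulChains_zero (x : ι → R) {f : Finset ι → M}
    (hf : f ∈ koszulChains R ι M 0) : koszulD x M f = 0 := by
  ext t
  refine Finset.sum_eq_zero fun j hj => ?_
  rw [hf, smul_zero]
  simp [Finset.card_insert_of_notMem (Finset.mem_compl.1 hj)]

theorem compLeft_mem_koszulCycles (x : ι → R) (φ : M →ₗ[R] N) {i : ℕ} {f : Finset ι → M}
    (hf : f ∈ koszulCycles x M i) : φ.compLeft (Finset ι) f ∈ koszulCycles x N i :=
  mem_koszulCycles_iff.2 ⟨compLeft_mem_koszulChains φ hf.1, by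
    rw [koszulD_compLeft, LinearMap.mem_ker.1 hf.2, map_zero]⟩

theorem compLeft_mem_koszulBoundaries (x : ι → R) (φ : M →ₗ[R] N) {i : ℕ} {f : Finset ι → M}
    (hf : f ∈ koszulBoundaries x M i) : φ.compLeft (Finset ι) f ∈ koszulBoundaries x N i := by
  obtain ⟨g, hg, rfl⟩ := hf
  exact ⟨_, compLeft_mem_koszulChains φ hg, koszulD_compLeft x φ g⟩

/-- The class of a cycle in Koszul homology. -/
def koszulClass (x : ι → R) (M : Type v) [AddCommGroup M] [Module R M] (i : ℕ) :
    koszulCycles x M i →ₗ[R] KoszulHomology x M i :=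
  Submodule.mkQ _

theorem koszulClass_surjective (x : ι → R) (M : Type v) [AddCommGroup M] [Module R M] (i : ℕ) :
    Function.Surjective (koszulClass x M i) :=
  Submodule.mkQ_surjective _

theorem koszulClass_eq_zero_iff (x : ι → R) {i : ℕ} (z : koszulCycles x M i) :
    koszulClass x M i z = 0 ↔ z.1 ∈ koszulBoundaries x M i :=
  Submodule.Quotient.mk_eq_zero _

/-- The map on Koszul homology induced by a linear map. -/
def koszulHomologyMap (x : ι → R) (φ : M →ₗ[R] N) (i : ℕ) :
    KoszulHomology x M i →ₗ[R] KoszulHomology x N i :=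
  Submodule.mapQ _ _
    ((φ.compLeft (Finset ι)).restrict fun _ hf => compLeft_mem_koszulCycles x φ hf)
    fun _ hf => compLeft_mem_koszulBoundaries x φ hf

theorem koszulHomologyMap_koszulClass (x : ι → R) (φ : M →ₗ[R] N) (i : ℕ)
    (z : koszulCycles x M i) :
    koszulHomologyMap x φ i (koszulClass x M i z) =
      koszulClass x N i ⟨φ.compLeft (Finset ι) z, compLeft_mem_koszulCycles x φ z.2⟩ :=
  rfl

theorem koszulHomologyMap_koszulClass_eq_zero_iff (x : ι → R) (φ : M →ₗ[R] N) (i : ℕ)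
    (z : koszulCycles x M i) :
    koszulHomologyMap x φ i (koszulClass x M i z) = 0 ↔
      φ.compLeft (Finset ι) z.1 ∈ koszulBoundaries x N i := by
  rw [koszulHomologyMap_koszulClass, koszulClass_eq_zero_iff]

/-- Koszul homology commutes with finite powers. -/
theorem nonempty_koszulHomology_pi_equiv (x : ι → R) (M : Type v) [AddCommGroup M] [Module R M]
    {κ : Type*} (i : ℕ) :
    Nonempty (KoszulHomology x (κ → M) i ≃ₗ[R] (κ → KoszulHomology x M i)) := by
  refine ⟨LinearEquiv.ofBijective
    (LinearMap.pi fun k => koszulHomologyMap x (LinearMap.proj k) i) ⟨?_, ?_⟩⟩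
  · rw [← LinearMap.ker_eq_bot, LinearMap.ker_eq_bot']
    intro h hh
    obtain ⟨z, rfl⟩ := koszulClass_surjective _ _ _ h
    have hk : ∀ k, ∃ y ∈ koszulChains R ι M (i + 1), koszulD x M y =
        (LinearMap.proj (R := R) (φ := fun _ : κ => M) k).compLeft (Finset ι) z.1 := fun k =>
      (koszulHomologyMap_koszulClass_eq_zero_iff x _ i z).1 (congrFun hh k)
    choose y hy hyz using hk
    rw [koszulClass_eq_zero_iff]
    refine ⟨fun s k => y k s, fun s hs => funext fun k => hy k s hs, ?_⟩
    ext s k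
    have := congrFun (hyz k) s
    simpa [koszulD_apply] using this
  · intro h
    have hk : ∀ k, ∃ z, koszulClass x M i z = h k := fun k => koszulClass_surjective _ _ _ (h k)
    choose z hz using hk
    refine ⟨koszulClass x (κ → M) i
      ⟨fun s k => (z k).1 s, fun s hs => funext fun k => (z k).2.1 s hs, ?_⟩, funext fun k => ?_⟩
    · refine LinearMap.mem_ker.2 (funext fun s => funext fun k => ?_)
      have := congrFun (LinearMap.mem_ker.1 (z k).2.2) s
      simpa [koszulD_apply] using this
    · rw [← hz k]
      rfl

section ShortExact

variable {x : ι → R} {φ : M →ₗ[R] N} {ψ : N →ₗ[R] P} {i : ℕ}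

/-- The correspondence underlying the connecting homomorphism of a short exact sequence
`0 → M → N → P → 0`: pairs `(y, a)` of chains of `N` and `M` with `∂ y = φ a`. -/
def connectingPairs (x : ι → R) (φ : M →ₗ[R] N) (i : ℕ) :
    Submodule R ((Finset ι → N) × (Finset ι → M)) :=
  (koszulChains R ι N (i + 1)).prod (koszulChains R ι M i) ⊓
    LinearMap.ker ((koszulD x N).coprod (-(φ.compLeft (Finset ι))))

theorem mem_connectingPairs_iff {p : (Finset ι → N) × (Finset ι → M)} :
    p ∈ connectingPairs x φ i ↔ (p.1 ∈ koszulChains R ι N (i + 1) ∧ p.2 ∈ koszulChains R ι M i) ∧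
      koszulD x N p.1 = φ.compLeft (Finset ι) p.2 := by
  rw [connectingPairs, Submodule.mem_inf, Submodule.mem_prod, LinearMap.mem_ker,
    LinearMap.coprod_apply, LinearMap.neg_apply, ← sub_eq_add_neg, sub_eq_zero]

/-- If `H_{i+1}(x; N) = 0`, then the connecting homomorphism identifies `H_{i+1}(x; P)` with the
kernel of `H_i(x; M) → H_i(x; N)`. -/
theorem nonempty_koszulHomology_equiv_ker (hφ : Function.Injective φ) (hψ : Function.Surjective ψ)
    (h : Function.Exact φ ψ) (hN : koszulCycles x N (i + 1) ≤ koszulBoundaries x N (i + 1)) :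
    Nonempty (KoszulHomology x P (i + 1) ≃ₗ[R] LinearMap.ker (koszulHomologyMap x φ i)) := by
  -- The connecting map is treated as a relation: `W` surjects onto `H_{i+1}(x; P)` by `α` and onto
  -- the kernel by `γ`. Equality of `ker α` and `ker γ` then identifies the two targets.
  let W := connectingPairs x φ i
  have hp (p : W) : ψ.compLeft (Finset ι) p.1.1 ∈ koszulCycles x P (i + 1) :=
    mem_koszulCycles_iff.2 ⟨compLeft_mem_koszulChains ψ p.2.1.1, by
      rw [koszulD_compLeft, (mem_connectingPairs_iff.1 p.2).2,
        compLeft_compLeft_of_exact h]⟩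
  have hq (p : W) : p.1.2 ∈ koszulCycles x M i :=
    ⟨p.2.1.2, compLeft_injective hφ (by
      rw [← koszulD_compLeft, ← (mem_connectingPairs_iff.1 p.2).2, koszulD_koszulD, map_zero])⟩
  let α : W →ₗ[R] KoszulHomology x P (i + 1) := koszulClass x P (i + 1) ∘ₗ
    LinearMap.codRestrict _ (ψ.compLeft (Finset ι) ∘ₗ LinearMap.fst R _ _ ∘ₗ W.subtype) hp
  let γ : W →ₗ[R] KoszulHomology x M i := koszulClass x M i ∘ₗ
    LinearMap.codRestrict _ (LinearMap.snd R _ _ ∘ₗ W.subtype) hq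
  have hα : Function.Surjective α := by
    intro c
    obtain ⟨z, rfl⟩ := koszulClass_surjective _ _ _ c
    obtain ⟨y, hy, hyz⟩ := exists_koszulChains_lift_of_surjective hψ z.2.1
    obtain ⟨a, ha, hay⟩ := exists_koszulChains_lift_of_exact h (koszulD_mem_koszulChains x hy)
      (by rw [← koszulD_compLeft, hyz, LinearMap.mem_ker.1 z.2.2])
    refine ⟨⟨(y, a), mem_connectingPairs_iff.2 ⟨⟨hy, ha⟩, hay.symm⟩⟩, ?_⟩
    exact congrArg (koszulClass x P (i + 1)) (Subtype.ext hyz)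
  have hγ : LinearMap.range γ = LinearMap.ker (koszulHomologyMap x φ i) := by
    ext c
    obtain ⟨z, rfl⟩ := koszulClass_surjective _ _ _ c
    rw [LinearMap.mem_ker, koszulHomologyMap_koszulClass_eq_zero_iff]
    constructor
    · rintro ⟨p, hp⟩
      have : koszulClass x M i (⟨p.1.2, hq p⟩ - z) = 0 := by
        rw [map_sub, sub_eq_zero]
        exact hp
      rw [koszulClass_eq_zero_iff] at this
      have h1 := compLeft_mem_koszulBoundaries x φ this
      have h2 : φ.compLeft (Finset ι) p.1.2 ∈ koszulBoundaries x N i :=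
        ⟨p.1.1, p.2.1.1, (mem_connectingPairs_iff.1 p.2).2⟩
      have := Submodule.sub_mem _ h2 h1
      rwa [← map_sub, Submodule.coe_sub, sub_sub_cancel] at this
    · rintro ⟨y, hy, hyz⟩
      exact ⟨⟨(y, z.1), mem_connectingPairs_iff.2 ⟨⟨hy, z.2.1⟩, hyz⟩⟩, rfl⟩
  have hker : LinearMap.ker α = LinearMap.ker γ := by
    ext p
    have hα' : α p = 0 ↔ ψ.compLeft (Finset ι) p.1.1 ∈ koszulBoundaries x P (i + 1) :=
      koszulClass_eq_zero_iff x _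
    have hγ' : γ p = 0 ↔ p.1.2 ∈ koszulBoundaries x M i := koszulClass_eq_zero_iff x _
    rw [LinearMap.mem_ker, LinearMap.mem_ker, hα', hγ']
    have hd := (mem_connectingPairs_iff.1 p.2).2
    constructor
    · rintro ⟨w, hw, hwp⟩
      obtain ⟨w', hw', rfl⟩ := exists_koszulChains_lift_of_surjective hψ hw
      obtain ⟨a, ha, hap⟩ := exists_koszulChains_lift_of_exact h
        (Submodule.sub_mem _ p.2.1.1 (koszulD_mem_koszulChains x hw'))
        (by rw [map_sub, ← hwp, koszulD_compLeft, sub_self])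
      refine ⟨a, ha, compLeft_injective hφ ?_⟩
      rw [← koszulD_compLeft, hap, map_sub, koszulD_koszulD, sub_zero, hd]
    -- Injectivity of the connecting map, the only place where vanishing of `H_{i+1}(x; N)` enters.
    · rintro ⟨a, ha, hap⟩
      have : p.1.1 - φ.compLeft (Finset ι) a ∈ koszulCycles x N (i + 1) :=
        mem_koszulCycles_iff.2 ⟨Submodule.sub_mem _ p.2.1.1 (compLeft_mem_koszulChains φ ha), by
          rw [map_sub, hd, koszulD_compLeft, hap, sub_self]⟩
      have := compLeft_mem_koszulBoundaries x ψ (hN this)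
      rwa [map_sub, compLeft_compLeft_of_exact h, sub_zero] at this
  exact ⟨(α.quotKerEquivOfSurjective hα).symm ≪≫ₗ Submodule.quotEquivOfEq _ _ hker ≪≫ₗ
    γ.quotKerEquivRange ≪≫ₗ LinearEquiv.ofEq _ _ hγ⟩

end ShortExact

end Functoriality

/-! ### Depth sensitivity of Koszul homology -/

section Depth

variable {R : Type u} [CommRing R] {ι : Type} [LinearOrder ι] [Fintype ι]

theorem smul_mem_koszulBoundaries_of_mem_span (x : ι → R) {M : Type v} [AddCommGroup M]
    [Module R M] {i : ℕ} {a : R} (ha : a ∈ Ideal.span (Set.range x)) {z : Finset ι → M}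
    (hz : z ∈ koszulCycles x M i) : a • z ∈ koszulBoundaries x M i := by
  have : Ideal.span (Set.range x) ≤
      (koszulBoundaries x M i).comap ((LinearMap.id : R →ₗ[R] R).smulRight z) := by
    rw [Ideal.span_le]
    rintro _ ⟨j, rfl⟩
    exact smul_mem_koszulBoundaries x M i j hz
  exact this ha

/-- Depth sensitivity: a weakly regular sequence of length `d` in the ideal generated by `e`
elements makes the Koszul homology vanish in the degrees above `e - d`. -/
theorem koszulCycles_le_koszulBoundaries_of_isWeaklyRegular (x : ι → R) (rs : List R)
    (hrs : ∀ r ∈ rs, r ∈ Ideal.span (Set.range x)) (M : Type v) [AddCommGroup M] [Module R M]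
    (h : RingTheory.Sequence.IsWeaklyRegular M rs) {i : ℕ}
    (hi : Fintype.card ι < i + rs.length) : koszulCycles x M i ≤ koszulBoundaries x M i := by
  induction rs generalizing M i with
  | nil =>
    intro z hz
    have : z = 0 := by
      ext s
      refine hz.1 s fun hs => ?_
      have := s.card_le_univ
      simp only [List.length_nil] at hi
      omega
    rw [this]
    exact Submodule.zero_mem _
  | cons a rs ih =>
    rw [RingTheory.Sequence.isWeaklyRegular_cons_iff] at h
    intro z hz
    let π : M →ₗ[R] QuotSMulTop a M := Submodule.mkQ _
    have hex : Function.Exact (LinearMap.lsmul R M a) π := by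
      intro m
      rw [Submodule.mkQ_apply, Submodule.Quotient.mk_eq_zero,
        Submodule.mem_smul_pointwise_iff_exists]
      simp
    -- Since `a` lies in the ideal, `a z = ∂y`, and `y` is a cycle modulo `a`. Its degree `i + 1`
    -- makes up for the shorter sequence, so induction gives `y = ∂w' + a v`. Then `a z = a ∂v`, and
    -- `a` cancels.
    obtain ⟨y, hy, hyz⟩ := smul_mem_koszulBoundaries_of_mem_span x (hrs a (by simp)) hz
    have hy' : π.compLeft (Finset ι) y ∈ koszulCycles x (QuotSMulTop a M) (i + 1) :=
      mem_koszulCycles_iff.2 ⟨compLeft_mem_koszulChains π hy, by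
        rw [koszulD_compLeft, hyz]
        exact compLeft_compLeft_of_exact hex z⟩
    obtain ⟨w, hw, hwy⟩ := ih (fun r hr => hrs r (by simp [hr])) _ h.2
      (by simp only [List.length_cons] at hi; omega) hy'
    obtain ⟨w', hw', rfl⟩ :=
      exists_koszulChains_lift_of_surjective (Submodule.mkQ_surjective _ : Function.Surjective π) hw
    obtain ⟨v, hv, hvy⟩ := exists_koszulChains_lift_of_exact hex
      (Submodule.sub_mem _ hy (koszulD_mem_koszulChains x hw'))
      (by rw [map_sub, ← hwy, koszulD_compLeft, sub_self])
    refine ⟨v, hv, compLeft_injective (φ := LinearMap.lsmul R M a) h.1 ?_⟩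
    rw [← koszulD_compLeft, hvy, map_sub, koszulD_koszulD, sub_zero, hyz]
    rfl

end Depth

/-! ### Vanishing criteria, and modules killed by the sequence -/

section Vanishing

variable {R : Type u} [CommRing R] {ι : Type} [LinearOrder ι] [Fintype ι]

theorem koszulCycles_le_koszulBoundaries_iff (x : ι → R) (M : Type v) [AddCommGroup M]
    [Module R M] (i : ℕ) :
    koszulCycles x M i ≤ koszulBoundaries x M i ↔ Subsingleton (KoszulHomology x M i) := by
  rw [Submodule.Quotient.subsingleton_iff, Submodule.submoduleOf_eq_top]

theorem koszulCycles_pi_le_koszulBoundaries {x : ι → R} {M : Type v} [AddCommGroup M]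
    [Module R M] {i : ℕ} (h : koszulCycles x M i ≤ koszulBoundaries x M i) (κ : Type*) :
    koszulCycles x (κ → M) i ≤ koszulBoundaries x (κ → M) i := by
  rw [koszulCycles_le_koszulBoundaries_iff] at h ⊢
  obtain ⟨e⟩ := nonempty_koszulHomology_pi_equiv (κ := κ) x M i
  exact e.toEquiv.subsingleton

/-- Chains of degree `i` as functions on the index sets with `i` elements. -/
def koszulChainsEquiv (R : Type u) [CommRing R] (ι : Type) (M : Type v) [AddCommGroup M]
    [Module R M] (i : ℕ) : koszulChains R ι M i ≃ₗ[R] ({s : Finset ι // s.card = i} → M) where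
  toFun f s := f.1 s
  map_add' _ _ := rfl
  map_smul' _ _ := rfl
  invFun g := ⟨fun s => if h : s.card = i then g ⟨s, h⟩ else 0, fun s hs => by simp [hs]⟩
  left_inv f := by
    ext s
    by_cases hs : s.card = i
    · simp [hs]
    · simp [hs, f.2 s hs]
  right_inv g := by
    ext s
    simp [s.2]

/-- The differential is zero, so the homology is the chain module itself, a power of `M` indexed by
the `i`-element index sets. -/
theorem length_koszulHomology_of_smul_eq_zero (x : ι → R) (M : Type v) [AddCommGroup M]
    [Module R M] (h : ∀ j (a : M), x j • a = 0) (i : ℕ) :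
    Module.length R (KoszulHomology x M i) =
      (Fintype.card ι).choose i * Module.length R M := by
  have hD : ∀ f : Finset ι → M, koszulD x M f = 0 := fun f => by
    ext t
    simp [koszulD_apply, mul_smul, h]
  have hZ : koszulCycles x M i = koszulChains R ι M i :=
    le_antisymm inf_le_left fun f hf => ⟨hf, hD f⟩
  have hB : (koszulBoundaries x M i).submoduleOf (koszulCycles x M i) = ⊥ := by
    rw [eq_bot_iff]
    rintro z ⟨f, -, hf⟩
    rw [hD f] at hf
    exact (Submodule.mem_bot R).2 (Subtype.ext hf.symm)
  rw [((Submodule.quotEquivOfEqBot _ hB) ≪≫ₗ LinearEquiv.ofEq _ _ hZ ≪≫ₗ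
    koszulChainsEquiv R ι M i).length_eq, Module.length_pi]
  congr 1
  rw [ENat.card_eq_coe_fintype_card, Fintype.card_finset_len]

end Vanishing

/-! ### Matrices with entries in the ideal -/

section Matrix

variable {R : Type u} [CommRing R] {κ κ' : Type*} [Fintype κ] [DecidableEq κ]

theorem linearMap_pi_apply_eq_sum (φ : (κ → R) →ₗ[R] (κ' → R)) (v : κ → R) (l : κ') :
    φ v l = ∑ k, v k * φ (Pi.single k 1) l := by
  conv_lhs => rw [pi_eq_sum_univ' v]
  simp [map_sum]

variable [Fintype κ'] [DecidableEq κ'] {ι : Type} [LinearOrder ι] [Fintype ι]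

/-- A matrix with entries in the ideal generated by `x` induces zero in Koszul homology. -/
theorem compLeft_mem_koszulBoundaries_of_apply_single_mem (x : ι → R)
    (φ : (κ → R) →ₗ[R] (κ' → R))
    (h : ∀ k l, φ (Pi.single k 1) l ∈ Ideal.span (Set.range x)) {i : ℕ}
    {z : Finset ι → κ → R} (hz : z ∈ koszulCycles x (κ → R) i) :
    φ.compLeft (Finset ι) z ∈ koszulBoundaries x (κ' → R) i := by
  -- Expansion of `φ` into elementary matrices: each summand is an element of the ideal times a
  -- cycle, hence a boundary.
  have : φ.compLeft (Finset ι) z = ∑ k, ∑ l, φ (Pi.single k 1) l •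
      (LinearMap.single R (fun _ : κ' => R) l ∘ₗ
        (LinearMap.proj k : (κ → R) →ₗ[R] R)).compLeft (Finset ι) z := by
    ext s l
    simp only [LinearMap.compLeft_apply, Function.comp_apply, linearMap_pi_apply_eq_sum φ (z s) l,
      Finset.sum_apply, Pi.smul_apply, LinearMap.coe_comp, LinearMap.coe_proj, Function.eval,
      LinearMap.coe_single, Pi.single_apply, smul_eq_mul, mul_ite, mul_zero,
      Finset.sum_ite_eq, Finset.mem_univ, if_true]
    exact Finset.sum_congr rfl fun k _ => mul_comm _ _
  rw [this]
  exact Submodule.sum_mem _ fun k _ => Submodule.sum_mem _ fun l _ =>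
    smul_mem_koszulBoundaries_of_mem_span x (h k l) (compLeft_mem_koszulCycles x _ hz)

end Matrix

theorem mem_of_mem_smul_top_pi {R : Type u} [CommRing R] {I : Ideal R} {κ : Type*}
    {v : κ → R} (hv : v ∈ I • (⊤ : Submodule R (κ → R))) (k : κ) : v k ∈ I := by
  have : I • (⊤ : Submodule R (κ → R)) ≤ Submodule.comap (LinearMap.proj k : (κ → R) →ₗ[R] R) I := by
    rw [Submodule.smul_le]
    intro r hr w _
    exact I.mul_mem_right _ hr
  exact this hv

/-! ### Codepth and Koszul homology over a local ring -/

section Local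

variable {R : Type u} [CommRing R] [IsLocalRing R]

/-- The supremum defining the depth need not be known to be attained: if every such sequence were
shorter than `e - m`, the depth would be at most `e - m - 1`, against `hm`. -/
theorem exists_isWeaklyRegular_of_codepth_le {m : ℕ} (hm : codepth R ≤ m) :
    ∃ rs : List R, (∀ r ∈ rs, r ∈ maximalIdeal R) ∧ RingTheory.Sequence.IsWeaklyRegular R rs ∧
      embDim R ≤ m + rs.length := by
  by_contra! hcon
  -- The empty sequence yields `m < e`, so the truncated subtraction `e - m - 1` is harmless.
  have h0 := hcon [] (by simp) (RingTheory.Sequence.IsWeaklyRegular.nil R R)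
  have hd : depth R ≤ ((embDim R - m - 1 : ℕ) : ℕ∞) := by
    refine iSup₂_le fun rs hrs => ?_
    have := hcon rs hrs.1 hrs.2.toIsWeaklyRegular
    exact_mod_cast (by omega : rs.length ≤ embDim R - m - 1)
  have h1 : (embDim R : ℕ∞) ≤ m + depth R := by
    rw [add_comm]
    exact tsub_le_iff_left.1 hm
  have h2 : (embDim R : ℕ∞) ≤ ((m + (embDim R - m - 1) : ℕ) : ℕ∞) := by
    push_cast
    exact h1.trans (add_le_add le_rfl (by exact_mod_cast hd))
  have h3 : embDim R ≤ m + (embDim R - m - 1) := by exact_mod_cast h2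
  simp only [List.length_nil] at h0
  omega

/-- As `R → k` is surjective, `k`-dimension is `R`-length, which is additive on exact sequences of
`R`-modules without finiteness conditions. -/
theorem koszulH_eq_toNat_length {ι : Type} [Fintype ι] [LinearOrder ι] (x : ι → R)
    (hx : Ideal.span (Set.range x) = maximalIdeal R)
    (M : Type v) [AddCommGroup M] [Module R M] (i : ℕ) :
    koszulH x hx M i = (Module.length R (KoszulHomology x M i)).toNat := by
  let _ : Module (ResidueField R) (KoszulHomology x M i) :=
    (isTorsionBySet_koszulHomology x hx M i).module
  have : IsScalarTower R (ResidueField R) (KoszulHomology x M i) :=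
    (isTorsionBySet_koszulHomology x hx M i).isScalarTower
  rw [Module.length_eq_of_surjective (R := ResidueField R) (S := R) residue_surjective,
    Module.length_eq_rank]
  rfl

theorem length_koszulHomology_ne_top [IsNoetherianRing R] {ι : Type} [Fintype ι] [LinearOrder ι]
    (x : ι → R) (hx : Ideal.span (Set.range x) = maximalIdeal R)
    (M : Type v) [AddCommGroup M] [Module R M] [Module.Finite R M] (i : ℕ) :
    Module.length R (KoszulHomology x M i) ≠ ⊤ := by
  let _ : Module (ResidueField R) (KoszulHomology x M i) :=
    (isTorsionBySet_koszulHomology x hx M i).module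
  have : IsScalarTower R (ResidueField R) (KoszulHomology x M i) :=
    (isTorsionBySet_koszulHomology x hx M i).isScalarTower
  have : Module.Finite (ResidueField R) (KoszulHomology x M i) :=
    Module.Finite.of_restrictScalars_finite R _ _
  rw [Module.length_eq_of_surjective (R := ResidueField R) (S := R) residue_surjective,
    Module.length_eq_finrank]
  exact ENat.natCast_ne_top _

/-! ### Consequences of the minimality of the generators -/

section Minimal

variable [IsNoetherianRing R] {x : Fin (embDim R) → R}

/-- Minimal generators of the maximal ideal are linearly independent modulo its square. -/
theorem mem_maximalIdeal_of_sum_mul_mem_sq (hx : Ideal.span (Set.range x) = maximalIdeal R)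
    {a : Fin (embDim R) → R} (h : ∑ j, a j * x j ∈ maximalIdeal R ^ 2) (j : Fin (embDim R)) :
    a j ∈ maximalIdeal R := by
  have hxm : ∀ j, x j ∈ maximalIdeal R := fun j => hx ▸ Ideal.subset_span ⟨j, rfl⟩
  let y : Fin (embDim R) → maximalIdeal R := fun j => ⟨x j, hxm j⟩
  have hy : Submodule.span R (Set.range y) = ⊤ := by
    apply Submodule.map_injective_of_injective (maximalIdeal R).subtype_injective
    rw [Submodule.map_span, ← Set.range_comp, Submodule.map_top, Submodule.range_subtype]
    exact hx
  have hspan := CotangentSpace.span_image_eq_top_iff.2 hy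
  rw [← Set.range_comp] at hspan
  -- A spanning family of `e` vectors in the `e`-dimensional space `𝔪/𝔪²` is a basis.
  have hli := linearIndependent_of_top_le_span_of_card_eq_finrank hspan.ge (Fintype.card_fin _)
  have h0 : ∑ j, residue R (a j) • (maximalIdeal R).toCotangent (y j) = 0 := by
    have : (maximalIdeal R).toCotangent (∑ j, a j • y j) = 0 := by
      rw [Ideal.toCotangent_eq_zero]
      simpa [y] using h
    rw [map_sum] at this
    rw [← this]
    refine Finset.sum_congr rfl fun j _ => ?_
    rw [map_smul]
    exact algebraMap_smul (ResidueField R) (a j) _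
  exact (residue_eq_zero_iff _).1 (Fintype.linearIndependent_iff.1 hli _ h0 j)

/-- A chain of positive degree whose boundary lies in `𝔪² K` lies in `𝔪 K`. -/
theorem mem_maximalIdeal_of_koszulD_mem_sq (hx : Ideal.span (Set.range x) = maximalIdeal R)
    {κ : Type*} {i : ℕ} (hi : i ≠ 0) {u : Finset (Fin (embDim R)) → κ → R}
    (hu : u ∈ koszulChains R (Fin (embDim R)) (κ → R) i)
    (h : ∀ s k, koszulD x (κ → R) u s k ∈ maximalIdeal R ^ 2)
    (s : Finset (Fin (embDim R))) (k : κ) : u s k ∈ maximalIdeal R := by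
  by_cases hs : s.card = i
  · obtain ⟨j, hj⟩ : s.Nonempty := Finset.card_ne_zero.1 (hs ▸ hi)
    have hsum := h (s.erase j) k
    -- The coefficient of `∂u` at `s \ {j}` is a linear combination of the `x l` lying in `𝔪²`, so
    -- its coefficients lie in `𝔪`; the one at `l = j` is `± u s k`.
    have key := mem_maximalIdeal_of_sum_mul_mem_sq hx (a := fun l => if l ∈ s.erase j then 0 else
      (-1) ^ ((s.erase j).filter (· < l)).card * u (insert l (s.erase j)) k) (by
        convert hsum using 1
        rw [koszulD_apply, Finset.sum_apply, ← Finset.sum_subset (Finset.subset_univ (s.erase j)ᶜ)]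
        · refine Finset.sum_congr rfl fun l hl => ?_
          rw [if_neg (Finset.mem_compl.1 hl), Pi.smul_apply, smul_eq_mul]
          ring
        · intro l _ hl
          rw [if_pos (by simpa using hl), zero_mul]) j
    rw [if_neg (Finset.notMem_erase j s), Finset.insert_erase hj] at key
    rcases neg_one_pow_eq_or R ((s.erase j).filter (· < j)).card with h' | h' <;>
      simpa [h'] using key
  · rw [hu s hs]
    exact Submodule.zero_mem _

end Minimal

/-! ### Syzygies in short exact sequences -/

namespace MinimalFreeResolution

variable {M : Type v} [AddCommGroup M] [Module R M] (F : MinimalFreeResolution R M)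

theorem d_apply_mem (n : ℕ) (v : Fin (F.rank (n + 1)) → R) (k : Fin (F.rank n)) :
    F.d n v k ∈ maximalIdeal R :=
  mem_of_mem_smul_top_pi (F.minimal n ⟨v, rfl⟩) k

theorem d_apply_mem_sq (n : ℕ) {v : Fin (F.rank (n + 1)) → R}
    (hv : ∀ k, v k ∈ maximalIdeal R) (l : Fin (F.rank n)) :
    F.d n v l ∈ maximalIdeal R ^ 2 := by
  rw [linearMap_pi_apply_eq_sum, sq]
  exact Submodule.sum_mem _ fun k _ => Ideal.mul_mem_mul (hv k) (F.d_apply_mem n _ l)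

/-- The projection of the free module onto the syzygy. -/
def toSyzygy (n : ℕ) : (Fin (F.rank n) → R) →ₗ[R] F.Syzygy n :=
  Submodule.mkQ _

theorem toSyzygy_surjective (n : ℕ) : Function.Surjective (F.toSyzygy n) :=
  Submodule.mkQ_surjective _

theorem exact_d_toSyzygy (n : ℕ) : Function.Exact (F.d n) (F.toSyzygy n) :=
  LinearMap.exact_iff.2 (Submodule.ker_mkQ _)

/-- The inclusion of a syzygy into the next free module. -/
def fromSyzygy (n : ℕ) : F.Syzygy (n + 1) →ₗ[R] (Fin (F.rank n) → R) :=
  Submodule.liftQ _ (F.d n) (F.exact_succ n).linearMap_ker_eq.ge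

theorem fromSyzygy_injective (n : ℕ) : Function.Injective (F.fromSyzygy n) := by
  rw [← LinearMap.ker_eq_bot]
  exact Submodule.ker_liftQ_eq_bot _ _ _ (F.exact_succ n).linearMap_ker_eq.le

theorem exact_fromSyzygy_toSyzygy (n : ℕ) : Function.Exact (F.fromSyzygy n) (F.toSyzygy n) := by
  rw [LinearMap.exact_iff, fromSyzygy, Submodule.range_liftQ]
  exact Submodule.ker_mkQ _

end MinimalFreeResolution

/-! ### Koszul homology of the syzygies of the residue field -/

section Main

variable {x : Fin (embDim R) → R} (F : MinimalFreeResolution R (ResidueField R))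

theorem toSyzygy_zero_eq_zero {v : Fin (F.rank 0) → R} (hv : ∀ k, v k ∈ maximalIdeal R) :
    F.toSyzygy 0 v = 0 := by
  refine (F.exact_d_toSyzygy 0 v).2 ((F.exact_zero v).1 ?_)
  rw [pi_eq_sum_univ' v, map_sum]
  refine Finset.sum_eq_zero fun k _ => ?_
  rw [map_smul, ← algebraMap_smul (ResidueField R), ResidueField.algebraMap_eq,
    (residue_eq_zero_iff _).2 (hv k), zero_smul]

theorem length_koszulHomology_syzygy_zero (hx : Ideal.span (Set.range x) = maximalIdeal R)
    (m : ℕ) : Module.length R (KoszulHomology x (F.Syzygy 0) m) = (embDim R).choose m := by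
  have : IsSimpleModule R (ResidueField R) :=
    isSimpleModule_iff_isCoatom.2 (maximalIdeal.isMaximal R).1
  rw [length_koszulHomology_of_smul_eq_zero, F.syzygyZeroEquiv.length_eq, Module.length_eq_one,
    mul_one, Fintype.card_fin]
  intro j a
  obtain ⟨v, rfl⟩ := F.toSyzygy_surjective 0 a
  rw [← map_smul]
  refine toSyzygy_zero_eq_zero F fun k => Ideal.mul_mem_right _ _ ?_
  exact hx ▸ Ideal.subset_span ⟨j, rfl⟩

/-- In degree zero, `H_0(x; Ω_{n+1} k) → H_0(x; F_n)` is zero. -/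
theorem koszulHomologyMap_fromSyzygy_zero
    (hx : Ideal.span (Set.range x) = maximalIdeal R) (n : ℕ) :
    koszulHomologyMap x (F.fromSyzygy n) 0 = 0 := by
  refine LinearMap.ext fun c => ?_
  obtain ⟨z, rfl⟩ := koszulClass_surjective _ _ _ c
  rw [LinearMap.zero_apply, koszulHomologyMap_koszulClass_eq_zero_iff]
  -- In degree zero any lift to `F_{n+1}` is a cycle, and the composite to `F_n` is `F.d n`, whose
  -- entries lie in `𝔪`.
  obtain ⟨y, hy, hyz⟩ := exists_koszulChains_lift_of_surjective (F.toSyzygy_surjective (n + 1)) z.2.1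
  rw [← hyz]
  exact compLeft_mem_koszulBoundaries_of_apply_single_mem x (F.d n)
    (fun k l => hx.symm ▸ F.d_apply_mem n _ l)
    (mem_koszulCycles_iff.2 ⟨hy, koszulD_eq_zero_of_mem_koszulChains_zero x hy⟩)

variable [IsNoetherianRing R]

/-- A chain of `𝔪 K ⊗ F_n` of degree at least `m` that maps to a cycle of `K ⊗ Ω_n k` maps to a
boundary there, provided that `H_i(x; R) = 0` for `i > m`. In degree `m` the chain itself has to
be a cycle. -/
theorem toSyzygy_compLeft_mem_koszulBoundaries
    (hx : Ideal.span (Set.range x) = maximalIdeal R) {m : ℕ}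
    (hm : ∀ i, m < i → koszulCycles x R i ≤ koszulBoundaries x R i) (n : ℕ) {i : ℕ}
    {u : Finset (Fin (embDim R)) → Fin (F.rank n) → R}
    (hu : u ∈ koszulChains R (Fin (embDim R)) (Fin (F.rank n) → R) i)
    (humem : ∀ s k, u s k ∈ maximalIdeal R)
    (hcyc : koszulD x (F.Syzygy n) ((F.toSyzygy n).compLeft _ u) = 0)
    (hi : m < i ∨ m ≤ i ∧ koszulD x _ u = 0) :
    (F.toSyzygy n).compLeft _ u ∈ koszulBoundaries x (F.Syzygy n) i := by
  induction n generalizing i with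
  | zero =>
    have : (F.toSyzygy 0).compLeft _ u = 0 := funext fun s => toSyzygy_zero_eq_zero F (humem s)
    rw [this]
    exact Submodule.zero_mem _
  | succ n ih =>
    have hdcyc : (F.d n).compLeft _ u ∈ koszulCycles x (Fin (F.rank n) → R) i := by
      refine mem_koszulCycles_iff.2 ⟨compLeft_mem_koszulChains _ hu, ?_⟩
      rw [koszulD_compLeft]
      rw [koszulD_compLeft] at hcyc
      ext1 s
      have := congrArg (F.fromSyzygy n) (congrFun hcyc s)
      rwa [Pi.zero_apply, map_zero] at this
    have hmi : m ≤ i := hi.elim le_of_lt And.left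
    -- Above degree `m` homology vanishes; in degree `m` the cycle `u` is multiplied by a matrix
    -- over `𝔪`.
    obtain ⟨v, hv, hvu⟩ : (F.d n).compLeft _ u ∈ koszulBoundaries x (Fin (F.rank n) → R) i := by
      rcases hi with hi | ⟨-, hi⟩
      · exact koszulCycles_pi_le_koszulBoundaries (hm i hi) _ hdcyc
      · exact compLeft_mem_koszulBoundaries_of_apply_single_mem x _
          (fun k l => hx.symm ▸ F.d_apply_mem n _ l) (mem_koszulCycles_iff.2 ⟨hu, hi⟩)
    have hvmem := mem_maximalIdeal_of_koszulD_mem_sq hx (Nat.succ_ne_zero i) hv fun s k => by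
      rw [hvu]
      exact F.d_apply_mem_sq n (humem s) k
    -- The degree `i + 1` exceeds `m`, so `v` itself need not be a cycle.
    obtain ⟨w, hw, hwv⟩ := ih hv hvmem (by
      rw [koszulD_compLeft, hvu]
      exact compLeft_compLeft_of_exact (F.exact_d_toSyzygy n) u) (Or.inl (by omega))
    obtain ⟨w', hw', rfl⟩ := exists_koszulChains_lift_of_surjective (F.toSyzygy_surjective n) hw
    obtain ⟨a, ha, hav⟩ := exists_koszulChains_lift_of_exact (F.exact_fromSyzygy_toSyzygy n)
      (Submodule.sub_mem _ hv (koszulD_mem_koszulChains x hw'))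
      (by rw [map_sub, ← hwv, koszulD_compLeft, sub_self])
    refine ⟨a, ha, compLeft_injective (F.fromSyzygy_injective n) ?_⟩
    rw [← koszulD_compLeft, hav, map_sub, koszulD_koszulD, sub_zero, hvu]
    rfl

/-- In positive degrees, `H_m(x; Ω_{n+1} k) → H_m(x; F_n)` is surjective. -/
theorem koszulHomologyMap_fromSyzygy_surjective
    (hx : Ideal.span (Set.range x) = maximalIdeal R) {m : ℕ} (hm0 : m ≠ 0)
    (hm : ∀ i, m < i → koszulCycles x R i ≤ koszulBoundaries x R i) (n : ℕ) :
    Function.Surjective (koszulHomologyMap x (F.fromSyzygy n) m) := by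
  intro c
  obtain ⟨z, rfl⟩ := koszulClass_surjective _ _ _ c
  obtain ⟨hz, hz'⟩ := mem_koszulCycles_iff.1 z.2
  -- A cycle of positive degree has boundary `0 ∈ 𝔪²`, hence coefficients in `𝔪`. Its image over
  -- `Ω_n` is thus some `∂w`, and subtracting `∂w'` for a lift `w'` moves it into `Ω_{n+1}`.
  obtain ⟨w, hw, hwz⟩ := toSyzygy_compLeft_mem_koszulBoundaries F hx hm n hz
    (mem_maximalIdeal_of_koszulD_mem_sq hx hm0 hz fun s k => by
      rw [hz']
      exact Submodule.zero_mem _)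
    (by rw [koszulD_compLeft, hz', map_zero]) (Or.inr ⟨le_rfl, hz'⟩)
  obtain ⟨w', hw', rfl⟩ := exists_koszulChains_lift_of_surjective (F.toSyzygy_surjective n) hw
  obtain ⟨a, ha, haz⟩ := exists_koszulChains_lift_of_exact (F.exact_fromSyzygy_toSyzygy n)
    (Submodule.sub_mem _ hz (koszulD_mem_koszulChains x hw'))
    (by rw [map_sub, ← hwz, koszulD_compLeft, sub_self])
  have haD : koszulD x _ a = 0 := compLeft_injective (F.fromSyzygy_injective n) (by
    rw [← koszulD_compLeft, haz, map_sub, koszulD_koszulD, sub_zero, hz', map_zero])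
  refine ⟨koszulClass x (F.Syzygy (n + 1)) m ⟨a, mem_koszulCycles_iff.2 ⟨ha, haD⟩⟩, ?_⟩
  rw [koszulHomologyMap_koszulClass, ← sub_eq_zero, ← map_sub, koszulClass_eq_zero_iff]
  refine ⟨-w', Submodule.neg_mem _ hw', ?_⟩
  change _ = (F.fromSyzygy n).compLeft _ a - z.1
  rw [haz, map_neg]
  abel

/-- Rank-nullity for `H_m(Ω_{n+1}) → H_m(F_n)`: the kernel is `H_{m+1}(Ω_n)` by the connecting map,
and the image is zero or everything according to whether `m = 0`. -/
theorem length_koszulHomology_syzygy_succ (hx : Ideal.span (Set.range x) = maximalIdeal R) {m : ℕ}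
    (hm : ∀ i, m < i → koszulCycles x R i ≤ koszulBoundaries x R i) (n : ℕ) :
    Module.length R (KoszulHomology x (F.Syzygy (n + 1)) m) =
      F.rank n * (if m = 0 then 0 else Module.length R (KoszulHomology x R m)) +
        Module.length R (KoszulHomology x (F.Syzygy n) (m + 1)) := by
  set f := koszulHomologyMap x (F.fromSyzygy n) m with hf
  obtain ⟨e⟩ := nonempty_koszulHomology_equiv_ker (F.fromSyzygy_injective n)
    (F.toSyzygy_surjective n) (F.exact_fromSyzygy_toSyzygy n)
    (koszulCycles_pi_le_koszulBoundaries (hm (m + 1) (by omega)) _)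
  have hrange : Module.length R (LinearMap.range f) =
      F.rank n * (if m = 0 then 0 else Module.length R (KoszulHomology x R m)) := by
    split_ifs with h
    · subst h
      rw [hf, koszulHomologyMap_fromSyzygy_zero F hx, LinearMap.range_zero, Module.length_bot,
        mul_zero]
    · obtain ⟨e'⟩ := nonempty_koszulHomology_pi_equiv (κ := Fin (F.rank n)) x R m
      rw [((LinearEquiv.ofTop _ (LinearMap.range_eq_top.2
        (koszulHomologyMap_fromSyzygy_surjective F hx h hm n))) ≪≫ₗ e').length_eq,
        Module.length_pi]
      simp
  rw [Module.length_eq_add_of_exact (LinearMap.ker f).subtype f.rangeRestrict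
    (Submodule.subtype_injective _) f.surjective_rangeRestrict
    (LinearMap.exact_iff.2 (by rw [LinearMap.ker_rangeRestrict, Submodule.range_subtype])),
    hrange, e.length_eq, add_comm]

theorem length_koszulHomology_syzygy (hx : Ideal.span (Set.range x) = maximalIdeal R) {m : ℕ}
    (hm : ∀ i, m < i → koszulCycles x R i ≤ koszulBoundaries x R i) (n : ℕ) :
    Module.length R (KoszulHomology x (F.Syzygy n) m) =
      F.betti ((n : ℤ) - 1) * (if m = 0 then 0 else Module.length R (KoszulHomology x R m)) +
        (embDim R).choose (n + m) := by
  induction n generalizing m with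
  | zero =>
    rw [length_koszulHomology_syzygy_zero F hx, Nat.cast_zero, zero_sub, zero_add]
    -- `F.betti (-1)` reduces to `0`.
    change _ = ((0 : ℕ) : ℕ∞) * _ + _
    rw [Nat.cast_zero, zero_mul, zero_add]
  | succ n ih =>
    have hb : F.betti (((n + 1 : ℕ) : ℤ) - 1) = F.rank n := by
      rw [Nat.cast_succ, add_sub_cancel_right]
      rfl
    -- The inductive hypothesis is used in degree `m + 1`, where `H_{m+1}(x; R) = 0` kills its Betti
    -- term.
    have := (koszulCycles_le_koszulBoundaries_iff x R (m + 1)).1 (hm (m + 1) (by omega))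
    rw [length_koszulHomology_syzygy_succ F hx hm, ih fun i hi => hm i (by omega), hb,
      if_neg m.succ_ne_zero, Module.length_eq_zero (M := KoszulHomology x R (m + 1)), mul_zero,
      zero_add, add_right_comm n 1 m, add_assoc n m 1]

end Main

end Local

end KoszulSyzygy

theorem mainTheorem6 (R : Type*) [CommRing R] [IsLocalRing R] [IsNoetherianRing R]
    (x : Fin (KoszulSyzygy.embDim R) → R)
    (hx : Ideal.span (Set.range x) = IsLocalRing.maximalIdeal R)
    (F : KoszulSyzygy.MinimalFreeResolution R (IsLocalRing.ResidueField R))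
    (n m : ℕ) (hm : KoszulSyzygy.codepth R ≤ (m : ℕ∞)) :
    KoszulSyzygy.koszulH x hx (F.Syzygy n) m =
      F.betti ((n : ℤ) - 1) * KoszulSyzygy.koszulHTilde x hx m +
        (KoszulSyzygy.embDim R).choose (n + m) := by
  obtain ⟨rs, hrs, hreg, hlen⟩ := KoszulSyzygy.exists_isWeaklyRegular_of_codepth_le hm
  have hvan : ∀ i, m < i →
      KoszulSyzygy.koszulCycles x R i ≤ KoszulSyzygy.koszulBoundaries x R i := fun i hi =>
    KoszulSyzygy.koszulCycles_le_koszulBoundaries_of_isWeaklyRegular x rs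
      (fun r hr => hx.symm ▸ hrs r hr) R hreg (by rw [Fintype.card_fin]; omega)
  rw [KoszulSyzygy.koszulH_eq_toNat_length, KoszulSyzygy.length_koszulHomology_syzygy F hx hvan,
    KoszulSyzygy.koszulHTilde, KoszulSyzygy.koszulH_eq_toNat_length]
  -- `ENat.toNat` sends `⊤` to `0`, so finiteness is needed to pass it through the sum.
  have hfin := KoszulSyzygy.length_koszulHomology_ne_top x hx R m
  split_ifs with h
  · simp
  · lift Module.length R (KoszulSyzygy.KoszulHomology x R m) to ℕ using hfin with l
    norm_cast
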